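/- Let $(\Omega,\Sigma,\mu)$ be a measure space with finite (nonnegative) measure and let $X$ be a (real or complex) Banach space. For $A\in\Sigma$, a partition of $A$ means a countable (finite or infinite) family of pairwise disjoint nonempty sets $\Delta_i\in\Sigma$ with union $A$; a partition $\Gamma$ of $A$ is finer than a partition $\Pi$ of $A$ if every set of $\Gamma$ is contained in a set of $\Pi$. For a function $f:\Omega\to X$ and sampling points $T=\{t_i\}$, $t_i\in\Delta_i$, put $S(f,\{\Delta_i\},T)=\sum_i f(t_i)\,\mu(\Delta_i)$. The function $f$ is RL-integrable (Riemann–Lebesgue integrable) over $A$ with integral $x=(RL)\int_A f\,d\mu\in X$ if for every $\varepsilon>0$ there is a partition $\Pi$ of $A$ such that, for every partition $\Gamma$ of $A$ finer than $\Pi$ and every choice $T$ of sampling points for $\Gamma$, the series $S(f,\Gamma,T)$ converges absolutely and $\|S(f,\Gamma,T)-x\|<\varepsilon$. We call $f$ RL-integrable if it is RL-integrable over $\Omega$. A function $g:\Omega\to X$ is a Bochner-integrable equivalent of $f$ if $g$ is Bochner-integrable and, for every $A\in\Sigma$, $f$ is RL-integrable over $A$ and $(RL)\int_A f\,d\mu=(Bochner)\int_A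 g\,d\mu$. **Theorem.** Let $f:\Omega\to X$ be RL-integrable, and let $Y$ be a separable complemented subspace of $X$ (that is, $Y$ is the range of a continuous linear projection of $X$) that contains every value $(RL)\int_A f\,d\mu$, $A\in\Sigma$. Then $f$ has a Bochner-integrable equivalent. More precisely, for every continuous linear projection $P$ of $X$ onto $Y$, the function $Pf:\omega\mapsto P(f(\omega))$ is a Bochner-integrable equivalent of $f$. -/

import Mathlib

open MeasureTheory

namespace RLInt

/-- A partition of the set `A` into countably many (finitely or infinitely many) pairwise disjoint
nonempty measurable sets. -/
structure Partition {Ω : Type*} [MeasurableSpace Ω] (A : Set Ω) where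
  parts : Set (Set Ω)
  countable : parts.Countable
  measurableSet : ∀ D ∈ parts, MeasurableSet D
  nonempty : ∀ D ∈ parts, D.Nonempty
  pairwiseDisjoint : parts.PairwiseDisjoint id
  sUnion_eq : ⋃₀ parts = A

namespace Partition

variable {Ω : Type*} [MeasurableSpace Ω] {A : Set Ω}

/-- `G` follows (is finer than) `P`: every piece of `G` lies in a piece of `P`. As both are
partitions of the same set, each piece of `P` is then the union of the pieces of `G` inside it. -/
def Finer (G P : Partition A) : Prop :=
  ∀ D ∈ G.parts, ∃ E ∈ P.parts, D ⊆ E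

/-- `t` is a choice of sampling points for `P`, one in each piece. -/
def IsSampling (P : Partition A) (t : P.parts → Ω) : Prop :=
  ∀ D : P.parts, t D ∈ (D : Set Ω)

end Partition

section Integral

variable {Ω : Type*} [MeasurableSpace Ω] {X : Type*} [NormedAddCommGroup X] [NormedSpace ℝ X]

/-- The term of the RL integral sum that belongs to the piece `D`. -/
noncomputable def term (μ : Measure Ω) (f : Ω → X) {A : Set Ω} (P : Partition A)
    (t : P.parts → Ω) (D : P.parts) : X :=
  μ.real (D : Set Ω) • f (t D)

/-- The RL integral sum `S(f, P, t)`; meaningful when the terms are absolutely summable. -/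
noncomputable def rlSum (μ : Measure Ω) (f : Ω → X) {A : Set Ω} (P : Partition A)
    (t : P.parts → Ω) : X :=
  ∑' D : P.parts, term μ f P t D

/-- `f` is RL-integrable over `A` and `x` is its RL integral over `A`. -/
def HasRLIntegral (μ : Measure Ω) (f : Ω → X) (A : Set Ω) (x : X) : Prop :=
  ∀ ε : ℝ, 0 < ε → ∃ P : Partition A, ∀ G : Partition A, G.Finer P →
    ∀ t : G.parts → Ω, G.IsSampling t →
      Summable (fun D : G.parts => ‖term μ f G t D‖) ∧ ‖rlSum μ f G t - x‖ < ε

/-- RL-integrability over the set `A`. -/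
def RLIntegrableOn (μ : Measure Ω) (f : Ω → X) (A : Set Ω) : Prop :=
  ∃ x : X, HasRLIntegral μ f A x

/-- RL-integrability (over the whole space). -/
def RLIntegrable (μ : Measure Ω) (f : Ω → X) : Prop :=
  RLIntegrableOn μ f Set.univ

/-- `g` is a Bochner-integrable equivalent of `f`: it is Bochner-integrable, and over every
measurable set the RL integral of `f` exists and equals the Bochner integral of `g`. -/
def IsBochnerEquivalent (μ : Measure Ω) (f g : Ω → X) : Prop :=
  Integrable g μ ∧
    ∀ A : Set Ω, MeasurableSet A → HasRLIntegral μ f A (∫ ω in A, g ω ∂μ)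

end Integral

end RLInt

/-! Since `P` is continuous, `P ∘ f` is RL-integrable, and its values lie in the separable space
`Y`. By Pettis measurability it suffices that each real function `φ ∘ P ∘ f` is a.e. measurable. A
real RL-integrable `h` is: over fine partitions the sum of `μ D * diam (h '' D)` is small
(`OscLT.tsum_ediam_le`), so suitable step functions converge to `h` a.e.
(`RLIntegrable.aemeasurable`).

A strongly measurable RL-integrable function is Bochner-integrable: sampling each piece where the
norm is at least its average, absolute convergence bounds the integral of the norm
(`RLIntegrable.integrable`).

RL-integrability passes to subsets by the Cauchy criterion. If `x` is the RL integral of `f` over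
`A`, testing with real functionals shows that the Bochner integral of `P ∘ f` over `A` is `P x`, and
`P x = x` because `x ∈ Y`. -/

namespace RLInt

/-! ### Refinements, traces and unions of partitions -/

namespace Partition

variable {Ω : Type*} [MeasurableSpace Ω] {A B C : Set Ω}

lemma Finer.refl (P : Partition A) : P.Finer P := fun D hD => ⟨D, hD, subset_rfl⟩

lemma exists_isSampling (P : Partition A) : ∃ t : P.parts → Ω, P.IsSampling t :=
  ⟨fun D => (P.nonempty D D.2).some, fun D => (P.nonempty D D.2).some_mem⟩

lemma disjoint_parts (P : Partition A) :
    Pairwise (Function.onFun Disjoint (fun D : P.parts => (D : Set Ω))) := by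
  intro D E h
  exact P.pairwiseDisjoint D.2 E.2 (fun h' => h (Subtype.ext h'))

lemma iUnion_parts (P : Partition A) : ⋃ D : P.parts, (D : Set Ω) = A := by
  rw [← Set.sUnion_eq_iUnion, P.sUnion_eq]

/-- The partition into the nonempty members of a countable disjoint family. -/
def ofFamily {ι : Type*} [Countable ι] (s : ι → Set Ω) (hm : ∀ i, MeasurableSet (s i))
    (hd : ∀ i j, i ≠ j → Disjoint (s i) (s j)) (hA : ⋃ i, s i = A) : Partition A where
  parts := {D | D ∈ Set.range s ∧ D.Nonempty}
  countable := (Set.countable_range s).mono fun _ h => h.1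
  measurableSet := by rintro _ ⟨⟨i, rfl⟩, -⟩; exact hm i
  nonempty := fun _ h => h.2
  pairwiseDisjoint := by
    rintro _ ⟨⟨i, rfl⟩, -⟩ _ ⟨⟨j, rfl⟩, -⟩ h
    exact hd i j fun hij => h (by rw [hij])
  sUnion_eq := by
    rw [← hA]
    ext x
    simp only [Set.mem_sUnion, Set.mem_iUnion, Set.mem_ofPred_eq]
    constructor
    · rintro ⟨_, ⟨⟨i, rfl⟩, -⟩, hx⟩
      exact ⟨i, hx⟩
    · rintro ⟨i, hx⟩
      exact ⟨s i, ⟨⟨i, rfl⟩, ⟨x, hx⟩⟩, hx⟩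

/-- The common refinement of two partitions. -/
def inf (P Q : Partition A) : Partition A :=
  haveI := P.countable.to_subtype
  haveI := Q.countable.to_subtype
  ofFamily (fun p : P.parts × Q.parts => (p.1 : Set Ω) ∩ p.2)
    (fun p => (P.measurableSet _ p.1.2).inter (Q.measurableSet _ p.2.2))
    (by
      rintro ⟨D, E⟩ ⟨D', E'⟩ h
      by_cases hD : D = D'
      · have hE : E ≠ E' := fun hE => h (by rw [hD, hE])
        exact (Q.disjoint_parts hE).mono Set.inter_subset_right Set.inter_subset_right
      · exact (P.disjoint_parts hD).mono Set.inter_subset_left Set.inter_subset_left)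
    (by
      rw [Set.iUnion_prod']
      simp_rw [← Set.inter_iUnion, Q.iUnion_parts, ← Set.iUnion_inter, P.iUnion_parts,
        Set.inter_self])

lemma inf_finer_left (P Q : Partition A) : (P.inf Q).Finer P := by
  rintro _ ⟨⟨p, rfl⟩, -⟩
  exact ⟨p.1, p.1.2, Set.inter_subset_left⟩

lemma inf_finer_right (P Q : Partition A) : (P.inf Q).Finer Q := by
  rintro _ ⟨⟨p, rfl⟩, -⟩
  exact ⟨p.2, p.2.2, Set.inter_subset_right⟩

/-- The partition induced on a measurable subset. -/
def trace (P : Partition A) (hB : MeasurableSet B) (hBA : B ⊆ A) : Partition B :=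
  haveI := P.countable.to_subtype
  ofFamily (fun D : P.parts => (D : Set Ω) ∩ B)
    (fun D => (P.measurableSet _ D.2).inter hB)
    (fun _ _ h => (P.disjoint_parts h).mono Set.inter_subset_left Set.inter_subset_left)
    (by rw [← Set.iUnion_inter, P.iUnion_parts, Set.inter_eq_right.2 hBA])

lemma exists_subset_of_finer_trace {P : Partition A} {hB : MeasurableSet B} {hBA : B ⊆ A}
    {G : Partition B} (hG : G.Finer (P.trace hB hBA)) {D : Set Ω} (hD : D ∈ G.parts) :
    ∃ E ∈ P.parts, D ⊆ E := by
  obtain ⟨_, ⟨⟨E, rfl⟩, -⟩, h⟩ := hG D hD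
  exact ⟨E, E.2, h.trans Set.inter_subset_left⟩

lemma subset_of_mem (P : Partition A) {D : Set Ω} (hD : D ∈ P.parts) : D ⊆ A :=
  P.sUnion_eq ▸ Set.subset_sUnion_of_mem hD

/-- Pieces are nonempty; otherwise `∅` could belong to both families. -/
lemma disjoint_parts_of_disjoint (P : Partition A) (Q : Partition B) (h : Disjoint A B) :
    Disjoint P.parts Q.parts := by
  rw [Set.disjoint_left]
  intro D hP hQ
  obtain ⟨x, hx⟩ := P.nonempty D hP
  exact Set.disjoint_left.1 h (P.subset_of_mem hP hx) (Q.subset_of_mem hQ hx)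

/-- The union of partitions of two disjoint sets. -/
def union (P : Partition A) (Q : Partition B) (h : Disjoint A B) (hC : A ∪ B = C) :
    Partition C where
  parts := P.parts ∪ Q.parts
  countable := P.countable.union Q.countable
  measurableSet := by
    rintro D (hD | hD)
    exacts [P.measurableSet D hD, Q.measurableSet D hD]
  nonempty := by
    rintro D (hD | hD)
    exacts [P.nonempty D hD, Q.nonempty D hD]
  pairwiseDisjoint := by
    rintro D (hD | hD) E (hE | hE) hDE
    · exact P.pairwiseDisjoint hD hE hDE
    · exact h.mono (P.subset_of_mem hD) (Q.subset_of_mem hE)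
    · exact h.symm.mono (Q.subset_of_mem hD) (P.subset_of_mem hE)
    · exact Q.pairwiseDisjoint hD hE hDE
  sUnion_eq := by rw [Set.sUnion_union, P.sUnion_eq, Q.sUnion_eq, hC]

end Partition

/-! ### Cauchy criterion, restriction to subsets, linear images -/

section Cauchy

variable {Ω : Type*} [MeasurableSpace Ω] {X : Type*} [NormedAddCommGroup X] [NormedSpace ℝ X]
  {μ : Measure Ω} {f : Ω → X} {A B : Set Ω}

/-- The RL sums over partitions finer than `P` converge absolutely and differ from each other by
less than `ε`. -/
def OscLT (μ : Measure Ω) (f : Ω → X) (P : Partition A) (ε : ℝ) : Prop :=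
  ∀ G : Partition A, G.Finer P → ∀ t : G.parts → Ω, G.IsSampling t →
    Summable (fun D : G.parts => ‖term μ f G t D‖) ∧
    ∀ G' : Partition A, G'.Finer P → ∀ t' : G'.parts → Ω, G'.IsSampling t' →
      ‖rlSum μ f G t - rlSum μ f G' t'‖ < ε

lemma HasRLIntegral.exists_oscLT {x : X} (h : HasRLIntegral μ f A x) {ε : ℝ} (hε : 0 < ε) :
    ∃ P : Partition A, OscLT μ f P ε := by
  obtain ⟨P, hP⟩ := h (ε / 2) (half_pos hε)
  refine ⟨P, fun G hG t ht => ⟨(hP G hG t ht).1, fun G' hG' t' ht' => ?_⟩⟩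
  have h1 := (hP G hG t ht).2
  have h2 := (hP G' hG' t' ht').2
  calc ‖rlSum μ f G t - rlSum μ f G' t'‖
      = ‖(rlSum μ f G t - x) - (rlSum μ f G' t' - x)‖ := by rw [sub_sub_sub_cancel_right]
    _ ≤ _ := norm_sub_le _ _
    _ < ε := by linarith

/-- The Cauchy criterion for RL-integrability. -/
lemma exists_hasRLIntegral [CompleteSpace X]
    (h : ∀ ε : ℝ, 0 < ε → ∃ P : Partition A, OscLT μ f P ε) : ∃ x, HasRLIntegral μ f A x := by
  have hpos : ∀ n : ℕ, (0 : ℝ) < 1 / ((n : ℝ) + 1) := fun n => Nat.one_div_pos_of_nat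
  choose P hP using fun n : ℕ => h _ (hpos n)
  choose t ht using fun n => (P n).exists_isSampling
  set v : ℕ → X := fun n => rlSum μ f (P n) (t n) with hv
  have hclose : ∀ n, ∀ G : Partition A, G.Finer (P n) → ∀ s : G.parts → Ω, G.IsSampling s →
      ‖v n - rlSum μ f G s‖ < 1 / ((n : ℝ) + 1) := fun n G hG s hs =>
    (hP n (P n) (Partition.Finer.refl _) (t n) (ht n)).2 G hG s hs
  have hvv : ∀ n m, ‖v n - v m‖ < 1 / ((n : ℝ) + 1) + 1 / ((m : ℝ) + 1) := by
    intro n m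
    obtain ⟨s, hs⟩ := ((P n).inf (P m)).exists_isSampling
    have h1 := hclose n _ (Partition.inf_finer_left _ _) s hs
    have h2 := hclose m _ (Partition.inf_finer_right _ _) s hs
    rw [norm_sub_rev] at h2
    have := norm_sub_le_norm_sub_add_norm_sub (v n) (rlSum μ f ((P n).inf (P m)) s) (v m)
    linarith
  have hcauchy : CauchySeq v := by
    rw [Metric.cauchySeq_iff]
    intro ε hε
    obtain ⟨N, hN⟩ := exists_nat_one_div_lt (half_pos hε)
    refine ⟨N, fun m hm n hn => ?_⟩
    rw [dist_eq_norm]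
    have h1 := Nat.one_div_le_one_div (α := ℝ) hm
    have h2 := Nat.one_div_le_one_div (α := ℝ) hn
    have := hvv m n
    linarith
  obtain ⟨x, hx⟩ := cauchySeq_tendsto_of_complete hcauchy
  refine ⟨x, fun ε hε => ?_⟩
  obtain ⟨N, hN⟩ := exists_nat_one_div_lt (half_pos hε)
  obtain ⟨M, hM⟩ := Metric.tendsto_atTop.1 hx (ε / 2) (half_pos hε)
  set n := max N M
  have hn : 1 / ((n : ℝ) + 1) ≤ 1 / ((N : ℝ) + 1) := Nat.one_div_le_one_div (le_max_left _ _)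
  have hvx := hM n (le_max_right _ _)
  rw [dist_eq_norm] at hvx
  refine ⟨P n, fun G hG s hs => ⟨(hP n G hG s hs).1, ?_⟩⟩
  have h1 := hclose n G hG s hs
  rw [norm_sub_rev] at h1
  have := norm_sub_le_norm_sub_add_norm_sub (rlSum μ f G s) (v n) x
  linarith

/-- No piece belongs to both families, so the two samplings glue and the absolutely convergent sum
splits. -/
lemma exists_sampling_union [CompleteSpace X] (G : Partition A) (R : Partition B) (hAB : Disjoint A B)
    {C : Set Ω} (hC : A ∪ B = C) {t : G.parts → Ω} (ht : G.IsSampling t) {s : R.parts → Ω}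
    (hs : R.IsSampling s) :
    ∃ u : (G.union R hAB hC).parts → Ω, (G.union R hAB hC).IsSampling u ∧
      (Summable (fun D => ‖term μ f (G.union R hAB hC) u D‖) →
        Summable (fun D => ‖term μ f G t D‖) ∧
        rlSum μ f (G.union R hAB hC) u = rlSum μ f G t + rlSum μ f R s) := by
  classical
  have hdisj := G.disjoint_parts_of_disjoint R hAB
  let φ : Set Ω → X := fun D => if h : D ∈ G.parts then term μ f G t ⟨D, h⟩ else
    if h : D ∈ R.parts then term μ f R s ⟨D, h⟩ else 0
  have hφG : ∀ D : G.parts, φ D = term μ f G t D := fun D => by simp [φ]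
  have hφR : ∀ D : R.parts, φ D = term μ f R s D := fun D => by
    have : (D : Set Ω) ∉ G.parts := fun h => Set.disjoint_left.1 hdisj h D.2
    simp [φ, this]
  let u : (G.union R hAB hC).parts → Ω := fun D =>
    if h : (D : Set Ω) ∈ G.parts then t ⟨D, h⟩ else s ⟨D, D.2.resolve_left h⟩
  have hφu : ∀ D, term μ f (G.union R hAB hC) u D = φ D := by
    rintro ⟨D, hD⟩
    by_cases h : D ∈ G.parts
    · simp [φ, u, term, h]
    · have h' : D ∈ R.parts := hD.resolve_left h
      simp [φ, u, term, h, h']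
  refine ⟨u, ?_, fun hsum => ?_⟩
  · rintro ⟨D, hD⟩
    by_cases h : D ∈ G.parts
    · simpa [u, h] using ht ⟨D, h⟩
    · simpa [u, h] using hs ⟨D, hD.resolve_left h⟩
  · simp_rw [hφu] at hsum
    have hG : Summable fun D : G.parts => ‖φ D‖ :=
      hsum.comp_injective (i := Set.inclusion (Set.subset_union_left (t := R.parts)))
        (Set.inclusion_injective _)
    have hR : Summable fun D : R.parts => ‖φ D‖ :=
      hsum.comp_injective (i := Set.inclusion (Set.subset_union_right (s := G.parts)))
        (Set.inclusion_injective _)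
    refine ⟨by simpa only [hφG] using hG, ?_⟩
    have := Summable.tsum_union_disjoint (f := φ) hdisj (Summable.of_norm hG) (Summable.of_norm hR)
    simp_rw [hφG, hφR] at this
    simp_rw [rlSum, hφu]
    exact this

/-- Extend both partitions of `B` by one fixed sampled partition of `A \ B`; its contribution
cancels in the difference. -/
lemma OscLT.trace [CompleteSpace X] {P : Partition A} {ε : ℝ} (h : OscLT μ f P ε)
    (hA : MeasurableSet A) (hB : MeasurableSet B) (hBA : B ⊆ A) :
    OscLT μ f (P.trace hB hBA) ε := by
  set R := P.trace (hA.diff hB) Set.sdiff_subset with hR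
  obtain ⟨s, hs⟩ := R.exists_isSampling
  have hC : B ∪ A \ B = A := Set.union_sdiff_cancel hBA
  have hfin : ∀ G : Partition B, G.Finer (P.trace hB hBA) →
      (G.union R Set.disjoint_sdiff_right hC).Finer P := by
    rintro G hG D (hD | hD)
    · exact Partition.exists_subset_of_finer_trace hG hD
    · exact Partition.exists_subset_of_finer_trace (Partition.Finer.refl R) hD
  intro G hG t ht
  obtain ⟨u, hu, hsum⟩ := exists_sampling_union (μ := μ) (f := f) G R Set.disjoint_sdiff_right hC
    ht hs
  have hGu := h _ (hfin G hG) u hu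
  obtain ⟨h1, h2⟩ := hsum hGu.1
  refine ⟨h1, fun G' hG' t' ht' => ?_⟩
  obtain ⟨u', hu', hsum'⟩ := exists_sampling_union (μ := μ) (f := f) G' R
    Set.disjoint_sdiff_right hC ht' hs
  have hGu' := h _ (hfin G' hG') u' hu'
  have := hGu.2 _ (hfin G' hG') u' hu'
  rwa [h2, (hsum' hGu'.1).2, add_sub_add_right_eq_sub] at this

/-- RL-integrability passes to measurable subsets. -/
lemma RLIntegrableOn.mono_set [CompleteSpace X] (h : RLIntegrableOn μ f A)
    (hA : MeasurableSet A) (hB : MeasurableSet B) (hBA : B ⊆ A) : RLIntegrableOn μ f B := by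
  obtain ⟨x, hx⟩ := h
  refine exists_hasRLIntegral fun ε hε => ?_
  obtain ⟨P, hP⟩ := hx.exists_oscLT hε
  exact ⟨_, hP.trace hA hB hBA⟩

/-- Continuous linear maps commute with the RL integral. -/
lemma HasRLIntegral.map [CompleteSpace X] {Z : Type*} [NormedAddCommGroup Z] [NormedSpace ℝ Z]
    (L : X →L[ℝ] Z) {x : X}
    (h : HasRLIntegral μ f A x) : HasRLIntegral μ (fun ω => L (f ω)) A (L x) := by
  intro ε hε
  have hpos : 0 < ‖L‖ + 1 := by positivity
  obtain ⟨P, hP⟩ := h (ε / (‖L‖ + 1)) (by positivity)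
  refine ⟨P, fun G hG t ht => ?_⟩
  obtain ⟨h1, h2⟩ := hP G hG t ht
  have hterm : ∀ D, term μ (fun ω => L (f ω)) G t D = L (term μ f G t D) := fun D => by
    simp [term]
  have hsum : rlSum μ (fun ω => L (f ω)) G t = L (rlSum μ f G t) := by
    simp_rw [rlSum, hterm]
    exact (L.map_tsum h1.of_norm).symm
  refine ⟨?_, ?_⟩
  · simp_rw [hterm]
    exact Summable.of_nonneg_of_le (fun _ => norm_nonneg _) (fun D => L.le_opNorm _)
      (h1.mul_left ‖L‖)
  · rw [hsum, ← map_sub]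
    calc ‖L (rlSum μ f G t - x)‖ ≤ ‖L‖ * ‖rlSum μ f G t - x‖ := L.le_opNorm _
      _ ≤ (‖L‖ + 1) * ‖rlSum μ f G t - x‖ := by gcongr; linarith
      _ < (‖L‖ + 1) * (ε / (‖L‖ + 1)) := by gcongr
      _ = ε := by field_simp

end Cauchy

end RLInt

/-! ### Measurability and comparison with the Bochner integral -/

open scoped ENNReal Topology

namespace RLInt

/-- **Pettis measurability** for separable real Banach spaces, almost everywhere version. -/
lemma aestronglyMeasurable_of_dual {Ω : Type*} [MeasurableSpace Ω] {μ : Measure Ω} {Y : Type*}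
    [NormedAddCommGroup Y] [NormedSpace ℝ Y] [SecondCountableTopology Y] {g : Ω → Y}
    (hg : ∀ φ : StrongDual ℝ Y, AEMeasurable (fun ω => φ (g ω)) μ) :
    AEStronglyMeasurable g μ := by
  borelize Y
  obtain ⟨u, hu⟩ := TopologicalSpace.exists_dense_seq Y
  -- Functionals norming a dense sequence make the norm a countable supremum, so preimages of balls
  -- are null-measurable.
  choose φ hφ hφu using fun n => exists_dual_vector'' ℝ (u n)
  have hnorm : ∀ y : Y, IsLUB {a | ∃ n, φ n y = a} ‖y‖ := by
    intro y
    refine ⟨?_, fun b hb => ?_⟩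
    · rintro _ ⟨n, rfl⟩
      calc φ n y ≤ ‖φ n y‖ := le_abs_self _
        _ ≤ ‖φ n‖ * ‖y‖ := (φ n).le_opNorm y
        _ ≤ 1 * ‖y‖ := by gcongr; exact hφ n
        _ = ‖y‖ := one_mul _
    · refine le_of_forall_pos_le_add fun ε hε => ?_
      obtain ⟨n, hn⟩ := hu.exists_dist_lt y (half_pos hε)
      rw [dist_eq_norm] at hn
      have h1 : φ n y ≤ b := hb ⟨n, rfl⟩
      have h2 : φ n (u n - y) ≤ ‖u n - y‖ :=
        calc φ n (u n - y) ≤ ‖φ n (u n - y)‖ := le_abs_self _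
          _ ≤ ‖φ n‖ * ‖u n - y‖ := (φ n).le_opNorm _
          _ ≤ 1 * ‖u n - y‖ := by gcongr; exact hφ n
          _ = ‖u n - y‖ := one_mul _
      rw [map_sub, hφu, norm_sub_rev] at h2
      have h3 := norm_sub_norm_le y (u n)
      simp only [RCLike.ofReal_real_eq_id, id_eq] at h2
      linarith
  have hball : ∀ y r, NullMeasurableSet (g ⁻¹' Metric.ball y r) μ := by
    intro y r
    have : AEMeasurable (fun ω => ‖g ω - y‖) μ := by
      refine AEMeasurable.isLUB (f := fun n ω => φ n (g ω - y)) (fun n => ?_)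
        (Filter.Eventually.of_forall fun ω => hnorm (g ω - y))
      simp only [map_sub]
      exact (hg (φ n)).sub_const _
    have h := nullMeasurableSet_lt this (aemeasurable_const (b := r))
    convert h using 1
    ext ω
    simp [dist_eq_norm]
  have hopen : ∀ U : Set Y, IsOpen U → NullMeasurableSet (g ⁻¹' U) μ := by
    intro U hU
    choose! r hr hrU using fun y (hy : y ∈ U) => Metric.isOpen_iff.1 hU y hy
    obtain ⟨T, hTU, hT, hTeq⟩ := TopologicalSpace.countable_cover_nhdsWithin
      (f := fun y => Metric.ball y (r y)) (s := U)
      (fun y hy => mem_nhdsWithin_of_mem_nhds (Metric.ball_mem_nhds y (hr y hy)))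
    have : U = ⋃ y ∈ T, Metric.ball y (r y) :=
      hTeq.antisymm (Set.iUnion₂_subset fun y hy => hrU y (hTU hy))
    rw [this, Set.preimage_iUnion₂]
    exact NullMeasurableSet.biUnion hT fun y _ => hball y (r y)
  have hnull : NullMeasurable g μ := by
    have : @Measurable (NullMeasurableSpace Ω μ) Y _ _ g := measurable_of_isOpen hopen
    exact fun s hs => this hs
  exact hnull.aemeasurable.aestronglyMeasurable

section

variable {Ω : Type*} [MeasurableSpace Ω] {X : Type*} [NormedAddCommGroup X] [NormedSpace ℝ X]
  {μ : Measure Ω} {f : Ω → X} {A : Set Ω}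

/-- Move the sampling point of one piece only: all other terms cancel. -/
lemma OscLT.mul_norm_sub_le {P : Partition A} {ε : ℝ} (h : OscLT μ f P ε) [CompleteSpace X]
    {D : Set Ω} (hD : D ∈ P.parts) {x y : Ω} (hx : x ∈ D) (hy : y ∈ D) :
    μ.real D * ‖f x - f y‖ < ε := by
  classical
  obtain ⟨t, ht⟩ := P.exists_isSampling
  have hs : ∀ z ∈ D, P.IsSampling (Function.update t ⟨D, hD⟩ z) := by
    intro z hz E
    by_cases hE : E = ⟨D, hD⟩
    · subst hE; simpa using hz
    · simpa [hE] using ht E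
  obtain ⟨h1, h2⟩ := h P (Partition.Finer.refl P) _ (hs x hx)
  have h3 := (h P (Partition.Finer.refl P) _ (hs y hy)).1
  have h4 := h2 P (Partition.Finer.refl P) _ (hs y hy)
  rw [rlSum, rlSum, ← h1.of_norm.tsum_sub h3.of_norm, tsum_eq_single ⟨D, hD⟩] at h4
  · simpa [term, ← smul_sub, norm_smul, abs_of_nonneg (measureReal_nonneg (μ := μ))] using h4
  · intro E hE
    simp [term, hE]

/-- For real functions the total oscillation over a fine partition is small. -/
lemma OscLT.tsum_le {h : Ω → ℝ} {P : Partition A} {ε : ℝ} (hP : OscLT μ h P ε)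
    {t s : P.parts → Ω} (ht : P.IsSampling t) (hs : P.IsSampling s) :
    ∑' D : P.parts, ENNReal.ofReal (μ.real D * |h (t D) - h (s D)|) ≤ ENNReal.ofReal ε := by
  classical
  -- Swapping the two points where needed makes every difference nonnegative, so the sum of absolute
  -- values is a difference of two RL sums.
  let t' : P.parts → Ω := fun D => if h (s D) ≤ h (t D) then t D else s D
  let s' : P.parts → Ω := fun D => if h (s D) ≤ h (t D) then s D else t D
  have ht' : P.IsSampling t' := by
    intro D
    by_cases hD : h (s D) ≤ h (t D)
    · simpa [t', hD] using ht D
    · simpa [t', hD] using hs D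
  have hs' : P.IsSampling s' := by
    intro D
    by_cases hD : h (s D) ≤ h (t D)
    · simpa [s', hD] using hs D
    · simpa [s', hD] using ht D
  have habs : ∀ D : P.parts, μ.real D * |h (t D) - h (s D)| = term μ h P t' D - term μ h P s' D := by
    intro D
    by_cases hD : h (s D) ≤ h (t D)
    · simp [term, t', s', hD, abs_of_nonneg (sub_nonneg.2 hD), mul_sub]
    · simp [term, t', s', hD, abs_of_nonpos (sub_nonpos.2 (not_le.1 hD).le), mul_sub]
  obtain ⟨h1, h2⟩ := hP P (Partition.Finer.refl P) t' ht'
  have h3 := (hP P (Partition.Finer.refl P) s' hs').1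
  have h4 := h2 P (Partition.Finer.refl P) s' hs'
  rw [← ENNReal.ofReal_tsum_of_nonneg (fun D => by positivity)]
  · refine ENNReal.ofReal_le_ofReal ?_
    simp_rw [habs]
    rw [h1.of_norm.tsum_sub h3.of_norm]
    exact (le_abs_self _).trans h4.le
  · simp_rw [habs]
    exact h1.of_norm.sub h3.of_norm

/-- Two points of each piece realise at least half its diameter, whence the factor 2. -/
lemma OscLT.tsum_ediam_le [IsFiniteMeasure μ] {h : Ω → ℝ} {P : Partition A} {ε : ℝ}
    (hP : OscLT μ h P ε) :
    ∑' D : P.parts, μ D * Metric.ediam (h '' D) ≤ 2 * ENNReal.ofReal ε := by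
  have key : ∀ D : P.parts, ∃ x y : Ω, x ∈ (D : Set Ω) ∧ y ∈ (D : Set Ω) ∧
      μ D * Metric.ediam (h '' D) ≤ 2 * ENNReal.ofReal (μ.real D * |h x - h y|) := by
    intro D
    obtain ⟨z, hz⟩ := P.nonempty D D.2
    -- A null piece may have infinite diameter; `0 * ∞ = 0` discards it.
    by_cases h0 : μ D = 0
    · exact ⟨z, z, hz, hz, by simp [h0]⟩
    have hpos : 0 < μ.real D := ENNReal.toReal_pos h0 (measure_ne_top _ _)
    have hbdd : Metric.ediam (h '' D) ≠ ∞ := by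
      refine ne_top_of_le_ne_top (ENNReal.ofReal_ne_top (r := ε / μ.real D)) ?_
      refine Metric.ediam_le ?_
      rintro _ ⟨x, hx, rfl⟩ _ ⟨y, hy, rfl⟩
      rw [edist_dist, dist_eq_norm]
      refine ENNReal.ofReal_le_ofReal ?_
      rw [le_div_iff₀ hpos, mul_comm]
      exact (hP.mul_norm_sub_le D.2 hx hy).le
    by_cases hd0 : Metric.ediam (h '' D) = 0
    · exact ⟨z, z, hz, hz, by simp [hd0]⟩
    have hlt : ¬ Metric.ediam (h '' (D : Set Ω)) ≤ Metric.ediam (h '' (D : Set Ω)) / 2 :=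
      not_le.2 (ENNReal.half_lt_self hd0 hbdd)
    rw [Metric.ediam_le_iff] at hlt
    push Not at hlt
    obtain ⟨_, ⟨x, hx, rfl⟩, _, ⟨y, hy, rfl⟩, hxy⟩ := hlt
    refine ⟨x, y, hx, hy, ?_⟩
    rw [ENNReal.ofReal_mul measureReal_nonneg, ofReal_measureReal, mul_left_comm]
    gcongr
    rw [← Real.dist_eq, ← edist_dist, mul_comm]
    exact (ENNReal.div_le_iff (by simp) (by simp)).1 hxy.le
  choose t s ht hs hts using key
  calc _ ≤ ∑' D : P.parts, 2 * ENNReal.ofReal (μ.real D * |h (t D) - h (s D)|) :=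
        ENNReal.tsum_le_tsum hts
    _ = 2 * ∑' D : P.parts, ENNReal.ofReal (μ.real D * |h (t D) - h (s D)|) :=
        ENNReal.tsum_mul_left
    _ ≤ _ := by gcongr; exact hP.tsum_le ht hs

lemma Partition.setLIntegral_eq_tsum (P : Partition A) (F : Ω → ℝ≥0∞) :
    ∫⁻ ω in A, F ω ∂μ = ∑' D : P.parts, ∫⁻ ω in (D : Set Ω), F ω ∂μ := by
  have := P.countable.to_subtype
  rw [← lintegral_iUnion (fun D : P.parts => P.measurableSet D D.2) P.disjoint_parts,
    P.iUnion_parts]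

/-- The piece of a partition of the whole space that contains a given point. -/
lemma Partition.exists_index (P : Partition (Set.univ : Set Ω)) :
    ∃ idx : Ω → P.parts, (∀ ω, ω ∈ (idx ω : Set Ω)) ∧ @Measurable _ _ _ ⊤ idx ∧
      ∀ D : P.parts, idx ⁻¹' {D} = D := by
  have hex : ∀ ω, ∃ D : P.parts, ω ∈ (D : Set Ω) := fun ω => by
    rw [← Set.mem_iUnion, P.iUnion_parts]
    exact Set.mem_univ ω
  choose idx hidx using hex
  have hpre : ∀ D : P.parts, idx ⁻¹' {D} = D := by
    intro D
    ext ω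
    refine ⟨fun h => ?_, fun h => ?_⟩
    · have h' : idx ω = D := h
      exact h' ▸ hidx ω
    · by_contra hne
      exact Set.disjoint_left.1 (P.disjoint_parts hne) (hidx ω) h
  refine ⟨idx, hidx, ?_, hpre⟩
  have := P.countable.to_subtype
  let : MeasurableSpace P.parts := ⊤
  refine measurable_to_countable' fun D => ?_
  rw [hpre]
  exact P.measurableSet D D.2

/-- RL-integrable real functions are almost everywhere measurable. -/
lemma RLIntegrable.aemeasurable [IsFiniteMeasure μ] {h : Ω → ℝ} (hh : RLIntegrable μ h) :
    AEMeasurable h μ := by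
  obtain ⟨x, hx⟩ := hh
  -- Summable tolerances give the sum of the diameters a finite integral, so a.e. the diameters tend
  -- to 0.
  obtain ⟨δ, hδ, hδsum⟩ := ENNReal.exists_pos_sum_of_countable (ε := 1) one_ne_zero ℕ
  choose P hP using fun n => hx.exists_oscLT (ε := δ n) (NNReal.coe_pos.2 (hδ n))
  choose t ht using fun n => (P n).exists_isSampling
  choose idx hmem hmeas hpre using fun n => (P n).exists_index
  have hcomp : ∀ n {β : Type} [MeasurableSpace β] (F : (P n).parts → β),
      Measurable fun ω => F (idx n ω) := by
    intro n β _ F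
    let : MeasurableSpace (P n).parts := ⊤
    exact measurable_from_top.comp (hmeas n)
  have hdm : ∀ n, Measurable fun ω => Metric.ediam (h '' (idx n ω : Set Ω)) := fun n =>
    hcomp n (fun D => Metric.ediam (h '' (D : Set Ω)))
  have hint : ∀ n, ∫⁻ ω, Metric.ediam (h '' (idx n ω : Set Ω)) ∂μ ≤ 2 * δ n := by
    intro n
    rw [← setLIntegral_univ, (P n).setLIntegral_eq_tsum]
    refine le_trans (ENNReal.tsum_le_tsum fun D => ?_)
      ((hP n).tsum_ediam_le.trans (by rw [ENNReal.ofReal_coe_nnreal]))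
    have hcst : ∀ ω ∈ (D : Set Ω), Metric.ediam (h '' (idx n ω : Set Ω)) =
        Metric.ediam (h '' (D : Set Ω)) := by
      intro ω hω
      rw [← hpre n D] at hω
      rw [show idx n ω = D from hω]
    rw [setLIntegral_congr_fun ((P n).measurableSet D D.2) hcst, setLIntegral_const, mul_comm]
  have htot : ∫⁻ ω, ∑' n, Metric.ediam (h '' (idx n ω : Set Ω)) ∂μ ≠ ∞ := by
    rw [lintegral_tsum fun n => (hdm n).aemeasurable]
    refine ne_top_of_le_ne_top ?_ (ENNReal.tsum_le_tsum hint)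
    rw [ENNReal.tsum_mul_left]
    exact ENNReal.mul_ne_top (by simp) (hδsum.trans ENNReal.one_lt_top).ne
  refine aemeasurable_of_tendsto_metrizable_ae' (f := fun n ω => h (t n (idx n ω)))
    (fun n => (hcomp n fun D => h (t n D)).aemeasurable) ?_
  filter_upwards [ae_lt_top (Measurable.tsum hdm) htot] with ω hω
  rw [tendsto_iff_edist_tendsto_0]
  refine tendsto_of_tendsto_of_tendsto_of_le_of_le tendsto_const_nhds
    (ENNReal.tendsto_atTop_zero_of_tsum_ne_top hω.ne) (fun _ => zero_le) fun n => ?_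
  exact Metric.edist_le_ediam_of_mem (Set.mem_image_of_mem h (ht n (idx n ω)))
    (Set.mem_image_of_mem h (hmem n ω))

/-- A strongly measurable RL-integrable function is Bochner-integrable. -/
lemma RLIntegrable.integrable [CompleteSpace X] [IsFiniteMeasure μ] (hf : RLIntegrable μ f)
    (hm : AEStronglyMeasurable f μ) : Integrable f μ := by
  obtain ⟨x, hx⟩ := hf
  obtain ⟨P, hP⟩ := hx.exists_oscLT one_pos
  have key : ∀ D : P.parts, ∃ z ∈ (D : Set Ω),
      ∫⁻ ω in (D : Set Ω), ‖f ω‖ₑ ∂μ ≤ ENNReal.ofReal (μ.real D * ‖f z‖) := by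
    intro D
    obtain ⟨z, hz⟩ := P.nonempty D D.2
    by_cases h0 : μ D = 0
    · exact ⟨z, hz, by simp [Measure.restrict_eq_zero.2 h0]⟩
    have hpos : 0 < μ.real D := ENNReal.toReal_pos h0 (measure_ne_top _ _)
    have hbdd : ∀ ω ∈ (D : Set Ω), ‖f ω‖ ≤ 1 / μ.real D + ‖f z‖ := by
      intro ω hω
      have h1 := (hP.mul_norm_sub_le D.2 hω hz).le
      rw [mul_comm, ← le_div_iff₀ hpos] at h1
      linarith [norm_sub_norm_le (f ω) (f z)]
    have hint : IntegrableOn (fun ω => ‖f ω‖) D μ :=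
      (IntegrableOn.of_bound (measure_lt_top _ _) hm.restrict _
        ((ae_restrict_iff' (P.measurableSet D D.2)).2 (Filter.Eventually.of_forall hbdd))).norm
    obtain ⟨y, hy, hle⟩ := exists_setAverage_le h0 (measure_ne_top _ _) hint
    refine ⟨y, hy, ?_⟩
    have := ofReal_integral_eq_lintegral_ofReal hint
      (Filter.Eventually.of_forall fun _ => norm_nonneg _)
    simp_rw [ofReal_norm] at this
    rw [← this]
    refine ENNReal.ofReal_le_ofReal ?_
    rw [setAverage_eq, smul_eq_mul, inv_mul_le_iff₀ hpos] at hle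
    exact hle
  choose t ht hle using key
  have hsum := (hP P (Partition.Finer.refl P) t ht).1
  refine ⟨hm, ?_⟩
  rw [hasFiniteIntegral_iff_enorm, ← setLIntegral_univ, P.setLIntegral_eq_tsum]
  refine lt_of_le_of_lt (ENNReal.tsum_le_tsum hle) ?_
  simp only [term, norm_smul, Real.norm_eq_abs, abs_of_nonneg (measureReal_nonneg (μ := μ))] at hsum
  rw [← ENNReal.ofReal_tsum_of_nonneg (fun D => by positivity) hsum]
  exact ENNReal.ofReal_lt_top

/-- Sampling each piece where `h` is at least its average gives an RL sum that majorises the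
integral. -/
lemma HasRLIntegral.setIntegral_le [IsFiniteMeasure μ] {h : Ω → ℝ} {x : ℝ}
    (hx : HasRLIntegral μ h A x) (hint : Integrable h μ) : ∫ ω in A, h ω ∂μ ≤ x := by
  refine le_of_forall_pos_le_add fun ε hε => ?_
  obtain ⟨P, hP⟩ := hx ε hε
  have := P.countable.to_subtype
  have key : ∀ D : P.parts, ∃ z ∈ (D : Set Ω),
      ∫ ω in (D : Set Ω), h ω ∂μ ≤ μ.real D * h z := by
    intro D
    obtain ⟨z, hz⟩ := P.nonempty D D.2
    by_cases h0 : μ D = 0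
    · exact ⟨z, hz, by simp [Measure.restrict_eq_zero.2 h0, Measure.real, h0]⟩
    have hpos : 0 < μ.real D := ENNReal.toReal_pos h0 (measure_ne_top _ _)
    obtain ⟨y, hy, hle⟩ := exists_setAverage_le h0 (measure_ne_top _ _) hint.integrableOn
    rw [setAverage_eq, smul_eq_mul, inv_mul_le_iff₀ hpos] at hle
    exact ⟨y, hy, hle⟩
  choose t ht hle using key
  obtain ⟨h1, h2⟩ := hP P (Partition.Finer.refl P) t ht
  have hs := hasSum_integral_iUnion (f := h) (fun D : P.parts => P.measurableSet D D.2)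
    P.disjoint_parts hint.integrableOn
  rw [P.iUnion_parts] at hs
  have h3 : ∫ ω in A, h ω ∂μ ≤ rlSum μ h P t := hasSum_le hle hs h1.of_norm.hasSum
  linarith [(abs_lt.1 (Real.norm_eq_abs _ ▸ h2)).2]

/-- For real functions, the RL integral agrees with the Lebesgue integral. -/
lemma HasRLIntegral.setIntegral_eq [IsFiniteMeasure μ] {h : Ω → ℝ} {x : ℝ}
    (hx : HasRLIntegral μ h A x) (hint : Integrable h μ) : ∫ ω in A, h ω ∂μ = x := by
  refine (hx.setIntegral_le hint).antisymm ?_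
  -- The reverse inequality is the same bound for `-h`.
  have := (hx.map (-ContinuousLinearMap.id ℝ ℝ)).setIntegral_le
    (by simpa using hint.neg)
  simpa [integral_neg] using this

/-- If the RL integrals of `f` are fixed by a continuous linear map `L` with separable range, then
`L ∘ f` is a Bochner-integrable equivalent of `f`. -/
lemma RLIntegrable.isBochnerEquivalent [CompleteSpace X] [IsFiniteMeasure μ]
    (hf : RLIntegrable μ f) (L : X →L[ℝ] X) (Y : Submodule ℝ X)
    (hY : TopologicalSpace.IsSeparable (Y : Set X)) (hLY : ∀ x, L x ∈ Y)
    (hfix : ∀ A : Set Ω, MeasurableSet A → ∀ x : X, HasRLIntegral μ f A x → L x = x) :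
    IsBochnerEquivalent μ f (fun ω => L (f ω)) := by
  have hLf : RLIntegrable μ (fun ω => L (f ω)) := by
    obtain ⟨x, hx⟩ := hf
    exact ⟨L x, hx.map L⟩
  have hm : AEStronglyMeasurable (fun ω => L (f ω)) μ := by
    have := hY.separableSpace
    have : SecondCountableTopology Y := UniformSpace.secondCountable_of_separable Y
    -- Pettis needs a second-countable target, hence the corestriction to `Y`.
    have hQ : AEStronglyMeasurable (fun ω => L.codRestrict Y hLY (f ω)) μ := by
      refine aestronglyMeasurable_of_dual fun φ => RLIntegrable.aemeasurable ?_
      obtain ⟨x, hx⟩ := hf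
      exact ⟨_, hx.map (φ.comp (L.codRestrict Y hLY))⟩
    exact Y.subtypeL.continuous.comp_aestronglyMeasurable hQ
  have hint := hLf.integrable hm
  refine ⟨hint, fun A hA => ?_⟩
  obtain ⟨x, hx⟩ := RLIntegrableOn.mono_set hf MeasurableSet.univ hA (Set.subset_univ A)
  have : ∫ ω in A, L (f ω) ∂μ = x := by
    refine (SeparatingDual.eq_iff_forall_dual_eq (R := ℝ)).2 fun φ => ?_
    rw [← φ.integral_comp_comm hint.integrableOn]
    refine ((hx.map (φ.comp L)).setIntegral_eq (φ.integrable_comp hint)).trans ?_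
    simp [hfix A hA x hx]
  rwa [this]

end

end RLInt

/-! ### The main theorem -/

theorem mainTheorem9 {𝕜 : Type*} [RCLike 𝕜]
    {X : Type*} [NormedAddCommGroup X] [NormedSpace ℝ X] [NormedSpace 𝕜 X]
    [IsScalarTower ℝ 𝕜 X] [CompleteSpace X]
    {Ω : Type*} [MeasurableSpace Ω] (μ : Measure Ω) [IsFiniteMeasure μ]
    (f : Ω → X) (hf : RLInt.RLIntegrable μ f)
    (Y : Submodule 𝕜 X) (hYsep : TopologicalSpace.IsSeparable (Y : Set X))
    (hYcompl : Y.ClosedComplemented)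
    (hfY : ∀ A : Set Ω, MeasurableSet A → ∀ x : X, RLInt.HasRLIntegral μ f A x → x ∈ Y) :
    (∃ g : Ω → X, RLInt.IsBochnerEquivalent μ f g) ∧
    ∀ P : X →L[𝕜] X, LinearMap.IsProj Y (P : X →ₗ[𝕜] X) →
      RLInt.IsBochnerEquivalent μ f (fun ω => P (f ω)) := by
  have key : ∀ P : X →L[𝕜] X, LinearMap.IsProj Y (P : X →ₗ[𝕜] X) →
      RLInt.IsBochnerEquivalent μ f (fun ω => P (f ω)) := fun P hP =>
    -- Real scalars suffice: real functionals already separate points.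
    hf.isBochnerEquivalent (P.restrictScalars ℝ) (Y.restrictScalars ℝ) hYsep
      (fun x => hP.map_mem x) fun A hA x hx => hP.map_id x (hfY A hA x hx)
  refine ⟨?_, key⟩
  obtain ⟨Q, hQ⟩ := hYcompl
  refine ⟨_, key (Y.subtypeL.comp Q) ⟨fun x => (Q x).2, fun x hx => ?_⟩⟩
  exact congrArg Subtype.val (hQ ⟨x, hx⟩)
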